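/- Let $\mathbb K=\mathbb R$ or $\mathbb C$, let $\Omega$ be a non-empty set, and let $(\mathcal F,\|\cdot\|)$ be a Banach space over $\mathbb K$ whose elements are functions $\Omega\to\mathbb K$, with pointwise linear operations. Write $B=\{f\in\mathcal F : \|f\|\le 1\}$, $\delta_x(f)=f(x)$, $\tau_{\mathrm p}$ for the topology of pointwise convergence on $\mathcal F$, $\tau_{\|\cdot\|}$ for the norm topology, and $\tau_0\le\tau_1$ if $\tau_0$ is coarser than $\tau_1$. Definitions. A locally convex Hausdorff space $Y$ is semi-Montel if its bounded sets are relatively compact, and semi-reflexive if the evaluation map $Y\to (Y_b')'$ is surjective, where $Y_b'$ is the dual $Y'$ with the topology of uniform convergence on the bounded subsets of $Y$. An isometric prebidual of $\mathcal F$ is a pair $(Y,\varphi)$ of a locally convex Hausdorff space $Y$ whose strong dual $Y_b'$ has its topology induced by a complete norm $|||\cdot|||$ and an isometric isomorphism $\varphi:\mathcal F\to (Y',|||\cdot|||)^*$. For a locally convex Hausdorff topology $\tau\le\tau_{\|\cdot\|}$ on $\mathcal F$, the mixed topology $\gamma=\gamma(\|\cdot\|,\tau)$ is the finest linear topology with $\tau\le\gamma\le\tau_{\|\cdot\|}$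 that coincides with $\tau$ on the $\|\cdot\|$-bounded sets; $(\mathcal F,\|\cdot\|,\tau)$ is a Saks space if some directed system $\Gamma$ of continuous seminorms generates $\tau$ and satisfies $\|f\|=\sup_{q\in\Gamma}q(f)$ for all $f\in\mathcal F$, and a semi-reflexive (semi-Montel) Saks space if moreover $(\mathcal F,\gamma)$ is semi-reflexive (semi-Montel). Theorem. The following assertions are equivalent. (a) $\mathcal F$ admits a strong isometric Banach linearisation, i.e. there are a Banach space $Y$ over $\mathbb K$, a map $\delta:\Omega\to Y$ and an isometric isomorphism $T:\mathcal F\to Y^*$ with $T(f)\circ\delta=f$ for all $f\in\mathcal F$. (b) $\mathcal F$ has an isometric prebidual $(Y,\varphi)$ with $Y$ complete and semi-Montel such that for every $x\in\Omega$ there is a unique $y_x'\in Y'$ with $\delta_x=\varphi(\cdot)(y_x')$. (c) $\mathcal F$ has an isometric prebidual $(Y,\varphi)$ such that for every $x\in\Omega$ there is a unique $y_x'\in Y'$ with $\delta_x=\varphi(\cdot)(y_x')$. (d) There is a locally convex Hausdorff topology $\tau$ on $\mathcal F$ with $\tau_{\mathrm p}\le\tau\le\tau_{\|\cdot\|}$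 such that $(\mathcal F,\|\cdot\|,\tau)$ is a semi-reflexive Saks space. (e) There is a locally convex Hausdorff topology $\tau$ on $\mathcal F$ with $\tau_{\mathrm p}\le\tau\le\tau_{\|\cdot\|}$ such that $(\mathcal F,\|\cdot\|,\tau)$ is a semi-Montel Saks space. (f) There is a locally convex Hausdorff topology $\tau$ on $\mathcal F$ with $\tau_{\mathrm p}\le\tau$ such that $B$ is $\tau$-compact. (g) There is a locally convex Hausdorff topology $\tau$ on $\mathcal F$ such that $B$ is $\tau$-compact (which forces $\tau\le\tau_{\|\cdot\|}$) and, for every $x\in\Omega$, $\delta_x$ is continuous for the mixed topology $\gamma(\|\cdot\|,\tau)$. (h) $B$ is $\tau_{\mathrm p}$-compact. -/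

import Mathlib

open Metric

universe u v

/-- `X` is a locally convex Hausdorff space over `𝕜`: a Hausdorff topological vector space whose
topology is generated by its continuous seminorms. -/
class LocallyConvexHausdorff (𝕜 X : Type*) [RCLike 𝕜] [AddCommGroup X] [Module 𝕜 X]
    [t : TopologicalSpace X] : Prop extends
    IsTopologicalAddGroup X, ContinuousSMul 𝕜 X, PolynormableSpace 𝕜 X, T2Space X

/-- Semi-Montel: every (von Neumann) bounded set is relatively compact. -/
def IsSemiMontel (𝕜 X : Type*) [RCLike 𝕜] [AddCommGroup X] [Module 𝕜 X]
    [t : TopologicalSpace X] : Prop :=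
  ∀ s : Set X, Bornology.IsVonNBounded 𝕜 s → IsCompact (closure s)

/-- Semi-reflexive: every continuous linear functional on the strong dual `X_b'` is the evaluation
at a point of `X`. The type `StrongDual 𝕜 X` carries the topology of uniform convergence on the
bounded subsets of `X`. -/
def IsSemiReflexive (𝕜 X : Type*) [RCLike 𝕜] [AddCommGroup X] [Module 𝕜 X]
    [t : TopologicalSpace X] : Prop :=
  ∀ Φ : StrongDual 𝕜 (StrongDual 𝕜 X), ∃ x : X, ∀ x' : StrongDual 𝕜 X, Φ x' = x' x

/-- The topology `τ_‖·‖` induced by the norm. -/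
@[reducible] def normTopology (X : Type*) [N : NormedAddCommGroup X] : TopologicalSpace X :=
  N.toPseudoMetricSpace.toUniformSpace.toTopologicalSpace

section Saks

variable (𝕜 : Type*) {X : Type*} [RCLike 𝕜] [NormedAddCommGroup X] [NormedSpace 𝕜 X]

/-- The linear topologies on `X` that lie between `τ` and the norm topology and coincide with `τ`
on the norm bounded sets. In the order of `TopologicalSpace X` finer topologies are smaller. -/
def mixedTopologies (τ : TopologicalSpace X) : Set (TopologicalSpace X) :=
  {t | @IsTopologicalAddGroup X t _ ∧ @ContinuousSMul 𝕜 X _ _ t ∧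
    normTopology X ≤ t ∧ t ≤ τ ∧
    ∀ s : Set X, Bornology.IsBounded s →
      t.induced ((↑) : s → X) = τ.induced ((↑) : s → X)}

/-- The mixed topology `γ(‖·‖, τ)`: the finest member of `mixedTopologies 𝕜 τ`. -/
@[reducible] def mixedTopology (τ : TopologicalSpace X) : TopologicalSpace X :=
  sInf (mixedTopologies 𝕜 τ)

/-- The finest member of `mixedTopologies 𝕜 τ` indeed exists. -/
theorem isLeast_mixedTopology (τ : TopologicalSpace X) (h₁ : @IsTopologicalAddGroup X τ _)
    (h₂ : @ContinuousSMul 𝕜 X _ _ τ) (hτ : normTopology X ≤ τ) :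
    IsLeast (mixedTopologies 𝕜 τ) (mixedTopology 𝕜 τ) := by
  have hmem : τ ∈ mixedTopologies 𝕜 τ := ⟨h₁, h₂, hτ, le_rfl, fun _ _ => rfl⟩
  refine ⟨⟨topologicalAddGroup_sInf fun t ht => ht.1, continuousSMul_sInf fun t ht => ht.2.1,
    le_sInf fun t ht => ht.2.2.1, sInf_le hmem, fun s hs => ?_⟩, fun t ht => sInf_le ht⟩
  refine le_antisymm (induced_mono (sInf_le hmem)) ?_
  rw [mixedTopology, induced_sInf]
  refine le_sInf ?_
  rintro _ ⟨t, ht, rfl⟩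
  exact (ht.2.2.2.2 s hs).ge

/-- `(X, ‖·‖, τ)` is a Saks space: `τ` is a locally convex Hausdorff topology coarser than the norm
topology, and some directed system of (automatically `τ`-continuous) seminorms generates `τ` and
has the norm as its pointwise supremum. -/
structure IsSaksSpace (τ : TopologicalSpace X) : Prop where
  locallyConvexHausdorff : LocallyConvexHausdorff 𝕜 X (t := τ)
  norm_le : normTopology X ≤ τ
  exists_seminorms : ∃ Γ : Set (Seminorm 𝕜 X), Γ.Nonempty ∧ DirectedOn (· ≤ ·) Γ ∧
    WithSeminorms (fun q : Γ => (q : Seminorm 𝕜 X)) (topology := τ) ∧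
    ∀ x : X, IsLUB {r : ℝ | ∃ q ∈ Γ, r = q x} ‖x‖

/-- A semi-reflexive Saks space: the mixed topology is semi-reflexive. -/
def IsSemiReflexiveSaksSpace (τ : TopologicalSpace X) : Prop :=
  IsSaksSpace 𝕜 τ ∧ IsSemiReflexive 𝕜 X (t := mixedTopology 𝕜 τ)

/-- A semi-Montel Saks space: the mixed topology is semi-Montel. -/
def IsSemiMontelSaksSpace (τ : TopologicalSpace X) : Prop :=
  IsSaksSpace 𝕜 τ ∧ IsSemiMontel 𝕜 X (t := mixedTopology 𝕜 τ)

end Saks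

/-- An isometric prebidual `(Y, φ)` of `X`: the strong dual `Y_b'` is completely normable by the
norm `dualNorm`, and `φ` is an isometric isomorphism of `X` onto the normed dual of
`(Y', dualNorm)`. As `dualNorm` induces the strong topology on `Y'`, that normed dual consists of
the elements of `StrongDual 𝕜 (StrongDual 𝕜 Y)`, normed by the supremum over the closed unit ball
of `dualNorm`. -/
structure IsometricPrebidual (𝕜 X Y : Type*) [RCLike 𝕜] [NormedAddCommGroup X] [NormedSpace 𝕜 X]
    [AddCommGroup Y] [Module 𝕜 Y] [TopologicalSpace Y] [LocallyConvexHausdorff 𝕜 Y] where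
  dualNorm : Seminorm 𝕜 (StrongDual 𝕜 Y)
  eq_zero_of_dualNorm : ∀ y' : StrongDual 𝕜 Y, dualNorm y' = 0 → y' = 0
  withSeminorms : WithSeminorms fun _ : Fin 1 => dualNorm
  complete : CompleteSpace (StrongDual 𝕜 Y)
  φ : X ≃ₗ[𝕜] StrongDual 𝕜 (StrongDual 𝕜 Y)
  isometry : ∀ x : X, IsLUB {r : ℝ | ∃ y' : StrongDual 𝕜 Y, dualNorm y' ≤ 1 ∧ r = ‖φ x y'‖} ‖x‖

/-- A strong isometric Banach linearisation `(δ, Y, T)` of the space `F` of functions on `Ω`. -/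
structure StrongIsometricBanachLinearisation (𝕜 F Ω Y : Type*) [RCLike 𝕜]
    [NormedAddCommGroup F] [NormedSpace 𝕜 F] [FunLike F Ω 𝕜]
    [NormedAddCommGroup Y] [NormedSpace 𝕜 Y] [CompleteSpace Y] where
  δ : Ω → Y
  T : F ≃ₗᵢ[𝕜] StrongDual 𝕜 Y
  apply_comp : ∀ f : F, T f ∘ δ = f

/-- The topology `τ_p` of pointwise convergence on a space `F` of functions on `Ω`. -/
@[reducible] def pointwiseTopology (𝕜 F : Type*) {Ω : Type*} [RCLike 𝕜] [FunLike F Ω 𝕜] :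
    TopologicalSpace F :=
  TopologicalSpace.induced (fun f : F => (f : Ω → 𝕜)) Pi.topologicalSpace

section Duality

open Filter Topology Pointwise

variable {𝕜 : Type*} [RCLike 𝕜]

theorem Balanced.norm_le_of_re_le {E : Type*} [AddCommGroup E] [Module 𝕜 E] {s : Set E}
    (hs : Balanced 𝕜 s) {f : E →ₗ[𝕜] 𝕜} {r : ℝ} (h : ∀ a ∈ s, RCLike.re (f a) ≤ r) {a : E}
    (ha : a ∈ s) : ‖f a‖ ≤ r := by
  obtain ⟨c, hc, hca⟩ := RCLike.exists_norm_eq_mul_self (f a)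
  have := h (c • a) (hs.smul_mem hc.le ha)
  rwa [map_smul, smul_eq_mul, ← hca, RCLike.ofReal_re] at this

theorem Balanced.linearMap_image {E F : Type*} [AddCommGroup E] [Module 𝕜 E] [AddCommGroup F]
    [Module 𝕜 F] {s : Set E} (hs : Balanced 𝕜 s) (f : E →ₗ[𝕜] F) : Balanced 𝕜 (f '' s) := by
  rintro c hc _ ⟨_, ⟨x, hx, rfl⟩, rfl⟩
  exact ⟨c • x, hs.smul_mem hc hx, map_smul f c x⟩

/-- Separation of a point from an absolutely convex closed set. -/
theorem exists_strongDual_norm_le_one_lt {E : Type*} [AddCommGroup E] [Module 𝕜 E] [Module ℝ E]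
    [IsScalarTower ℝ 𝕜 E] [TopologicalSpace E] [IsTopologicalAddGroup E] [ContinuousSMul 𝕜 E]
    [LocallyConvexSpace ℝ E] {s : Set E} (hne : s.Nonempty) (hb : Balanced 𝕜 s)
    (hc : Convex ℝ s) (hcl : IsClosed s) {x : E} (hx : x ∉ s) :
    ∃ f : StrongDual 𝕜 E, (∀ a ∈ s, ‖f a‖ ≤ 1) ∧ 1 < ‖f x‖ := by
  obtain ⟨f, r, hr, hrx⟩ := RCLike.geometric_hahn_banach_closed_point (𝕜 := 𝕜) hc hcl hx
  have h0 : 0 < r := by simpa using hr 0 (hb.zero_mem hne)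
  have hn : ∀ a ∈ s, ‖f a‖ ≤ r := fun a ha =>
    hb.norm_le_of_re_le (f := f.toLinearMap) (fun b hb' => (hr b hb').le) ha
  have hr' : ‖((r : 𝕜))⁻¹‖ = r⁻¹ := by rw [norm_inv, RCLike.norm_ofReal, abs_of_pos h0]
  refine ⟨((r : 𝕜)⁻¹) • f, fun a ha => ?_, ?_⟩
  · rw [_root_.smul_apply, norm_smul, hr', inv_mul_le_iff₀ h0, mul_one]
    exact hn a ha
  · rw [_root_.smul_apply, norm_smul, hr', lt_inv_mul_iff₀ h0, mul_one]
    exact hrx.trans_le (RCLike.re_le_norm _)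

/-- An absolutely convex set in an algebraic dual that is compact for the topology of pointwise
convergence contains its bipolar. -/
theorem LinearMap.mem_of_forall_norm_le {V : Type*} [AddCommGroup V] [Module 𝕜 V]
    {s : Set (V →ₗ[𝕜] 𝕜)} (hne : s.Nonempty) (hb : Balanced 𝕜 s) (hc : Convex ℝ s)
    (hs : IsCompact ((fun f v => f v) '' s : Set (V → 𝕜)))
    {Φ : V →ₗ[𝕜] 𝕜} (h : ∀ v r, (∀ f ∈ s, ‖f v‖ ≤ r) → ‖Φ v‖ ≤ r) : Φ ∈ s := by
  by_contra hΦ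
  let E : V →ₗ[𝕜] (V →ₗ[𝕜] 𝕜) →ₗ[𝕜] 𝕜 := LinearMap.id.flip
  let ι : (V →ₗ[𝕜] 𝕜) →ₗ[𝕜] V → 𝕜 := LinearMap.ltoFun 𝕜 V 𝕜 𝕜
  let _ : TopologicalSpace (V →ₗ[𝕜] 𝕜) := .induced ι inferInstance
  have hι : IsInducing ι := ⟨rfl⟩
  have : T2Space (V →ₗ[𝕜] 𝕜) := (IsEmbedding.mk hι DFunLike.coe_injective).t2Space
  have : IsTopologicalAddGroup (V →ₗ[𝕜] 𝕜) := topologicalAddGroup_induced ι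
  have : ContinuousSMul 𝕜 (V →ₗ[𝕜] 𝕜) := continuousSMul_induced ι
  have : LocallyConvexSpace ℝ (V →ₗ[𝕜] 𝕜) := .induced (ι.restrictScalars ℝ)
  obtain ⟨f, hf, hfx⟩ := exists_strongDual_norm_le_one_lt (𝕜 := 𝕜) hne hb hc
    (hι.isCompact_iff.2 hs).isClosed hΦ
  have hfE : f.toLinearMap ∈ Submodule.span 𝕜 (Set.range E) := by
    rw [LinearMap.mem_span_iff_continuous]
    refine continuous_iff_le_induced.2 ?_
    rw [← induced_to_pi]
    exact continuous_iff_le_induced.1 f.continuous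
  rw [← LinearMap.coe_range, Submodule.span_eq] at hfE
  obtain ⟨v, hv⟩ := hfE
  have hfv : ∀ g, f g = g v := fun g => (LinearMap.congr_fun hv g).symm
  simp only [hfv] at hf hfx
  exact hfx.not_ge (h v 1 hf)

/-- A form of the Banach–Alaoglu theorem: a pointwise bounded set that contains its bipolar in the
algebraic dual is compact for the topology of pointwise convergence. -/
theorem LinearMap.isCompact_image_coe {E V : Type*} [AddCommGroup E] [Module 𝕜 E]
    [AddCommGroup V] [Module 𝕜 V] (B : E →ₗ[𝕜] V →ₗ[𝕜] 𝕜) {s : Set E}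
    (hs : ∀ v, ∃ r, ∀ x ∈ s, ‖B x v‖ ≤ r)
    (h : ∀ Φ : V →ₗ[𝕜] 𝕜, (∀ v r, (∀ x ∈ s, ‖B x v‖ ≤ r) → ‖Φ v‖ ≤ r) → ∃ x ∈ s, B x = Φ) :
    IsCompact ((fun x v => B x v) '' s : Set (V → 𝕜)) := by
  let _ : TopologicalSpace E := .induced (fun x v => B x v) inferInstance
  have hind : IsInducing fun (x : E) v => B x v := ⟨rfl⟩
  rw [← hind.isCompact_iff]
  rw [isCompact_iff_ultrafilter_le_nhds]
  intro U hU
  have hsU : ∀ᶠ x in (U : Filter E), x ∈ s := le_principal_iff.1 hU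
  have hlim : ∀ v, ∃ c, Tendsto (fun x : E => B x v) U (𝓝 c) := by
    intro v
    obtain ⟨r, hr⟩ := hs v
    obtain ⟨c, -, hc⟩ := (isCompact_closedBall (0 : 𝕜) r).ultrafilter_le_nhds
      (U.map fun x : E => B x v) (le_principal_iff.2 <| Ultrafilter.mem_map.2 <| by
        filter_upwards [hsU] with x hx
        simpa using hr x hx)
    exact ⟨c, hc⟩
  choose Φ hΦ using hlim
  let Ψ : V →ₗ[𝕜] 𝕜 :=
    { toFun := Φ
      map_add' := fun v w => tendsto_nhds_unique (hΦ (v + w)) <| by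
        simpa using (hΦ v).add (hΦ w)
      map_smul' := fun c v => tendsto_nhds_unique (hΦ (c • v)) <| by
        simpa using (hΦ v).const_mul c }
  obtain ⟨x, hx, hxΨ⟩ := h Ψ fun v r hr =>
    le_of_tendsto (hΦ v).norm (hsU.mono fun x hx => hr x hx)
  refine ⟨x, hx, ?_⟩
  rw [nhds_induced, ← tendsto_iff_comap, tendsto_pi_nhds]
  intro v
  have : B x v = Φ v := by rw [hxΨ]; rfl
  simpa only [this] using hΦ v

theorem LinearMap.norm_le_inv_mul_of_forall_lt {E ι : Type*} [AddCommGroup E] [Module 𝕜 E]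
    {Φ : E →ₗ[𝕜] 𝕜} {l : ι → E →ₗ[𝕜] 𝕜} {r : ℝ} (hr : 0 < r)
    (h : ∀ e, (∀ i, ‖l i e‖ < r) → ‖Φ e‖ < 1) {e : E} {t : ℝ} (ht : 0 ≤ t)
    (he : ∀ i, ‖l i e‖ ≤ t) : ‖Φ e‖ ≤ r⁻¹ * t := by
  refine le_of_forall_pos_le_add fun ε hε => ?_
  have hpos : 0 < t + r * ε := by positivity
  have hmem := h (((r / (t + r * ε) : ℝ) : 𝕜) • e) fun i => by
    have : ‖l i e‖ < t + r * ε := (he i).trans_lt (by nlinarith [mul_pos hr hε])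
    rw [map_smul, norm_smul, RCLike.norm_ofReal,
      abs_of_pos (by positivity), div_mul_eq_mul_div, div_lt_iff₀ hpos]
    exact mul_lt_mul_of_pos_left this hr
  rw [map_smul, norm_smul, RCLike.norm_ofReal, abs_of_pos (by positivity),
    div_mul_eq_mul_div, div_lt_iff₀ hpos, one_mul] at hmem
  have := (lt_inv_mul_iff₀ hr).2 hmem
  rw [mul_add, inv_mul_cancel_left₀ hr.ne'] at this
  exact this.le

theorem LinearMap.exists_mem_smul_of_isCompact_image_coe {E V : Type*} [AddCommGroup E]
    [Module 𝕜 E] [Module ℝ E] [IsScalarTower ℝ 𝕜 E] [AddCommGroup V] [Module 𝕜 V]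
    (B : E →ₗ[𝕜] V →ₗ[𝕜] 𝕜) {s : Set E} (hs : IsCompact ((fun x v => B x v) '' s : Set (V → 𝕜)))
    (hne : s.Nonempty) (hbal : Balanced 𝕜 s) (hconv : Convex ℝ s) {Φ : V →ₗ[𝕜] 𝕜} {C : ℝ}
    (hC : 0 < C) (hΦ : ∀ v r, 0 ≤ r → (∀ x ∈ s, ‖B x v‖ ≤ r) → ‖Φ v‖ ≤ C * r) :
    ∃ x ∈ (C : 𝕜) • s, B x = Φ := by
  have hC' : (C : 𝕜) ≠ 0 := RCLike.ofReal_ne_zero.2 hC.ne'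
  obtain ⟨x, hx, hxΦ⟩ := LinearMap.mem_of_forall_norm_le (hne.image B) (hbal.linearMap_image B)
    (hconv.linear_image (B.restrictScalars ℝ)) (by rwa [Set.image_image])
    (Φ := (C : 𝕜)⁻¹ • Φ) fun v r hr => by
      obtain ⟨b, hb⟩ := hne
      have h0 : 0 ≤ r := (norm_nonneg _).trans (hr _ ⟨b, hb, rfl⟩)
      rw [LinearMap.smul_apply, norm_smul, norm_inv, RCLike.norm_ofReal, abs_of_pos hC,
        inv_mul_le_iff₀ hC]
      exact hΦ v r h0 fun x hx => hr _ ⟨x, hx, rfl⟩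
  refine ⟨(C : 𝕜) • x, Set.smul_mem_smul_set hx, ?_⟩
  rw [map_smul, hxΦ, smul_inv_smul₀ hC']

section TVS

variable {G : Type*} [AddCommGroup G] [Module 𝕜 G] [TopologicalSpace G]

/-- The evaluation pairing between a topological vector space and its dual. -/
def evalStrongDual (𝕜 G : Type*) [RCLike 𝕜] [AddCommGroup G] [Module 𝕜 G] [TopologicalSpace G] :
    G →ₗ[𝕜] StrongDual 𝕜 G →ₗ[𝕜] 𝕜 :=
  (ContinuousLinearMap.coeLM 𝕜).flip

@[simp]
theorem evalStrongDual_apply (x : G) (f : StrongDual 𝕜 G) : evalStrongDual 𝕜 G x f = f x := rfl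

variable {B : Set G}

theorem IsCompact.isSemiMontel [T2Space G] [ContinuousConstSMul 𝕜 G] (hB : IsCompact B)
    (habs : ∀ s, Bornology.IsVonNBounded 𝕜 s → ∃ c : 𝕜, s ⊆ c • B) : IsSemiMontel 𝕜 G := by
  intro s hs
  obtain ⟨c, hc⟩ := habs s hs
  exact (hB.image (continuous_const_smul c)).closure_of_subset hc

theorem exists_forall_norm_le_of_strongBidual (Φ : StrongDual 𝕜 (StrongDual 𝕜 G)) :
    ∃ s : Set G, Bornology.IsVonNBounded 𝕜 s ∧ ∃ C > 0, ∀ (f : StrongDual 𝕜 G) (r : ℝ),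
      0 ≤ r → (∀ x ∈ s, ‖f x‖ ≤ r) → ‖Φ f‖ ≤ C * r := by
  have h : {f : StrongDual 𝕜 G | ‖Φ f‖ < 1} ∈ 𝓝 0 :=
    (isOpen_lt Φ.continuous.norm continuous_const).mem_nhds (by simp)
  obtain ⟨⟨s, r⟩, ⟨hs, hr⟩, hsr⟩ :=
    (ContinuousLinearMap.hasBasis_nhds_zero_of_basis Metric.nhds_basis_ball).mem_iff.1 h
  refine ⟨s, hs, r⁻¹, inv_pos.2 hr, fun f t ht hf => ?_⟩
  exact LinearMap.norm_le_inv_mul_of_forall_lt (Φ := Φ.toLinearMap)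
    (l := fun x : s => evalStrongDual 𝕜 G x) hr
    (fun f hf => hsr fun x hx => mem_ball_zero_iff.2 (hf ⟨x, hx⟩)) ht fun x => hf x x.2

theorem IsCompact.isSemiReflexive [Module ℝ G] [IsScalarTower ℝ 𝕜 G] (hB : IsCompact B)
    (hne : B.Nonempty) (hbal : Balanced 𝕜 B) (hconv : Convex ℝ B)
    (habs : ∀ s, Bornology.IsVonNBounded 𝕜 s → ∃ c : 𝕜, s ⊆ c • B) : IsSemiReflexive 𝕜 G := by
  intro Φ
  obtain ⟨s, hs, C, hC, hΦ⟩ := exists_forall_norm_le_of_strongBidual Φ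
  obtain ⟨c, hc⟩ := habs s hs
  have hcont : Continuous fun (x : G) (f : StrongDual 𝕜 G) => evalStrongDual 𝕜 G x f :=
    continuous_pi fun f => f.continuous
  obtain ⟨x, -, hx⟩ := (evalStrongDual 𝕜 G).exists_mem_smul_of_isCompact_image_coe
    (hB.image hcont) hne hbal hconv (Φ := Φ.toLinearMap) (C := C * (‖c‖ + 1)) (by positivity)
    fun f r hr hf => by
      rw [mul_assoc]
      refine hΦ f _ (by positivity) fun x hx => ?_
      obtain ⟨b, hb, rfl⟩ := hc hx
      change ‖f (c • b)‖ ≤ _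
      rw [map_smul, norm_smul]
      have := hf b hb
      rw [evalStrongDual_apply] at this
      gcongr
      linarith
  exact ⟨x, fun f => (LinearMap.congr_fun hx f).symm⟩

/-- In a semi-reflexive space, a bounded set that equals its bipolar is weakly compact. -/
theorem IsSemiReflexive.isCompact_image_coe (h : IsSemiReflexive 𝕜 G)
    (hB : Bornology.IsVonNBounded 𝕜 B)
    (hsep : ∀ x ∉ B, ∃ f : StrongDual 𝕜 G, (∀ b ∈ B, ‖f b‖ ≤ 1) ∧ 1 < ‖f x‖) :
    IsCompact ((fun x f => f x) '' B : Set (StrongDual 𝕜 G → 𝕜)) := by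
  refine LinearMap.isCompact_image_coe (evalStrongDual 𝕜 G) (fun f => ?_) fun Φ hΦ => ?_
  · obtain ⟨r, hr⟩ := (NormedSpace.isVonNBounded_iff' 𝕜).1 (hB.image f)
    exact ⟨r, fun x hx => hr _ ⟨x, hx, rfl⟩⟩
  · have hcont : Continuous Φ := by
      refine continuous_of_continuousAt_zero Φ ?_
      rw [ContinuousAt, map_zero, Metric.nhds_basis_closedBall.tendsto_right_iff]
      intro ε hε
      filter_upwards [(ContinuousLinearMap.hasBasis_nhds_zero_of_basis
        Metric.nhds_basis_closedBall).mem_of_mem (i := (B, ε)) ⟨hB, hε⟩] with f hf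
      rw [mem_closedBall_zero_iff]
      exact hΦ f ε fun x hx => mem_closedBall_zero_iff.1 (hf x hx)
    obtain ⟨x, hx⟩ := h ⟨Φ, hcont⟩
    refine ⟨x, ?_, LinearMap.ext fun f => (hx f).symm⟩
    by_contra hxB
    obtain ⟨f, hf, hfx⟩ := hsep x hxB
    exact hfx.not_ge ((congrArg norm (hx f)).symm.trans_le (hΦ f 1 hf))

end TVS

end Duality

section CompactConvergence

open Filter Topology Pointwise CompactConvergenceCLM

variable {𝕜 X : Type*} [RCLike 𝕜] [NormedAddCommGroup X] [NormedSpace 𝕜 X]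

open scoped ComplexOrder in
instance CompactConvergenceCLM.polynormableSpace : PolynormableSpace 𝕜 (X →L_c[𝕜] 𝕜) := by
  have : LocallyConvexSpace 𝕜 𝕜 := .ofBasisZero 𝕜 𝕜 (ball 0) (0 < ·) Metric.nhds_basis_ball
    fun r _ => convex_of_nonneg_surjective_algebraMap (R := ℝ) 𝕜
      (fun _ => RCLike.nonneg_iff_exists_ofReal.mp) (convex_ball 0 r)
  have : LocallyConvexSpace 𝕜 (X →L_c[𝕜] 𝕜) :=
    UniformConvergenceCLM.locallyConvexSpace 𝕜 _ ⟨∅, isCompact_empty⟩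
      (directedOn_of_sup_mem fun _ _ => IsCompact.union)
  have : ContinuousSMul ℝ (X →L_c[𝕜] 𝕜) := IsScalarTower.continuousSMul 𝕜
  exact LocallyConvexSpace.toPolynormableSpace

instance CompactConvergenceCLM.locallyConvexHausdorff :
    LocallyConvexHausdorff 𝕜 (X →L_c[𝕜] 𝕜) where

instance CompactConvergenceCLM.completeSpace : CompleteSpace (X →L_c[𝕜] 𝕜) :=
  UniformConvergenceCLM.completeSpace _ _ CompactlyCoherentSpace.isCoherentWith
    Set.sUnion_isCompact_eq_univ

/-- The closed unit ball of the dual norm, as a subset of the dual with the topology of compact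
convergence. -/
def CompactConvergenceCLM.dualUnitBall (𝕜 X : Type*) [RCLike 𝕜] [NormedAddCommGroup X]
    [NormedSpace 𝕜 X] : Set (X →L_c[𝕜] 𝕜) :=
  {f | ∀ x, ‖f x‖ ≤ ‖x‖}

theorem CompactConvergenceCLM.isCompact_dualUnitBall : IsCompact (dualUnitBall 𝕜 X) := by
  have hS : IsCompact ((fun f : X →L_c[𝕜] 𝕜 => (f : X → 𝕜)) '' dualUnitBall 𝕜 X) := by
    let B : (X →L[𝕜] 𝕜) →ₗ[𝕜] X →ₗ[𝕜] 𝕜 := ContinuousLinearMap.coeLM 𝕜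
    refine LinearMap.isCompact_image_coe B (s := {f | ∀ x, ‖f x‖ ≤ ‖x‖})
      (fun v => ⟨‖v‖, fun f hf => hf v⟩) fun Φ hΦ => ?_
    have hb : ∀ x, ‖Φ x‖ ≤ ‖x‖ := fun x => hΦ x ‖x‖ fun f hf => hf x
    exact ⟨Φ.mkContinuous 1 (by simpa using hb), hb, rfl⟩
  have hequi : Equicontinuous fun f : dualUnitBall 𝕜 X => ((f : X →L_c[𝕜] 𝕜) : X → 𝕜) := by
    refine (LipschitzWith.uniformEquicontinuous _ 1 fun f =>
      LipschitzWith.of_dist_le_mul fun x y => ?_).equicontinuous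
    rw [dist_eq_norm, dist_eq_norm, ← map_sub, NNReal.coe_one, one_mul]
    exact f.2 (x - y)
  rw [isCompact_iff_compactSpace] at hS ⊢
  have hind : IsInducing fun f : dualUnitBall 𝕜 X => ((f : X →L_c[𝕜] 𝕜) : X → 𝕜) := by
    rw [← EquicontinuousOn.isInducing_uniformOnFun_iff_pi (𝔖 := {S : Set X | IsCompact S})
      Set.sUnion_isCompact_eq_univ (fun _ h => h) fun K _ => hequi.equicontinuousOn K]
    exact (UniformConvergenceCLM.isUniformInducing_coeFn _ _ _).isInducing.comp .subtypeVal
  rw [← isCompact_univ_iff, hind.isCompact_iff, Set.image_univ]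
  rw [← isCompact_iff_compactSpace] at hS
  convert hS using 1
  ext g
  simp

variable [CompleteSpace X]

theorem CompactConvergenceCLM.exists_subset_smul_dualUnitBall {s : Set (X →L_c[𝕜] 𝕜)}
    (hs : Bornology.IsVonNBounded 𝕜 s) : ∃ c : 𝕜, s ⊆ c • dualUnitBall 𝕜 X := by
  obtain ⟨C, hC⟩ := banach_steinhaus (g := fun f : s => (f.1 : X →L[𝕜] 𝕜)) fun x => by
    have := UniformConvergenceCLM.isVonNBounded_iff.1 hs {x} isCompact_singleton
    obtain ⟨r, hr⟩ := (NormedSpace.isVonNBounded_iff' 𝕜).1 this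
    exact ⟨r, fun f => hr _ ⟨f, f.2, x, rfl, rfl⟩⟩
  have hpos : 0 < |C| + 1 := by positivity
  have hne : ((|C| + 1 : ℝ) : 𝕜) ≠ 0 := RCLike.ofReal_ne_zero.2 hpos.ne'
  refine ⟨((|C| + 1 : ℝ) : 𝕜), fun f hf => ?_⟩
  rw [Set.mem_smul_set_iff_inv_smul_mem₀ hne]
  intro x
  change ‖((|C| + 1 : ℝ) : 𝕜)⁻¹ • f x‖ ≤ ‖x‖
  rw [norm_smul, norm_inv, RCLike.norm_ofReal, abs_of_pos hpos, inv_mul_le_iff₀ hpos]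
  have h1 : ‖f x‖ ≤ C * ‖x‖ := ContinuousLinearMap.le_of_opNorm_le (f : X →L[𝕜] 𝕜) (hC ⟨f, hf⟩) x
  refine h1.trans ?_
  gcongr
  linarith [le_abs_self C]

theorem CompactConvergenceCLM.isSemiMontel : IsSemiMontel 𝕜 (X →L_c[𝕜] 𝕜) :=
  isCompact_dualUnitBall.isSemiMontel fun _ => exists_subset_smul_dualUnitBall

theorem IsCompact.exists_isCompact_balanced_convex [NormedSpace ℝ X] [IsScalarTower ℝ 𝕜 X]
    {K : Set X} (hK : IsCompact K) :
    ∃ M, K ⊆ M ∧ IsCompact M ∧ M.Nonempty ∧ Balanced 𝕜 M ∧ Convex ℝ M := by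
  let D : Set X := closedBall (0 : 𝕜) 1 • insert 0 K
  have hD : Balanced 𝕜 D := by
    rintro c hc _ ⟨_, ⟨a, ha, x, hx, rfl⟩, rfl⟩
    refine ⟨c * a, ?_, x, hx, mul_smul c a x⟩
    rw [mem_closedBall_zero_iff] at ha ⊢
    rw [norm_mul]
    exact mul_le_one₀ hc (norm_nonneg _) ha
  have hKD : insert 0 K ⊆ D := fun x hx => ⟨1, by simp, x, hx, one_smul _ _⟩
  have hcomp : IsCompact D := (isCompact_closedBall (0 : 𝕜) 1).smul_set (hK.insert 0)
  refine ⟨closure (convexHull ℝ D), ?_, ?_, ?_, ?_, (convex_convexHull ℝ D).closure⟩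
  · exact ((Set.subset_insert _ _).trans hKD).trans
      ((subset_convexHull ℝ D).trans subset_closure)
  · exact hcomp.totallyBounded.convexHull.closure.isCompact_of_isClosed isClosed_closure
  · exact ⟨0, subset_closure (subset_convexHull ℝ D (hKD (Set.mem_insert _ _)))⟩
  · refine Balanced.closure fun c hc => ?_
    have := (LinearMap.lsmul 𝕜 X c).restrictScalars ℝ |>.image_convexHull D
    rw [show c • convexHull ℝ D = (LinearMap.lsmul 𝕜 X c).restrictScalars ℝ '' convexHull ℝ D
      from rfl, this]
    exact convexHull_mono (hD c hc)

theorem CompactConvergenceCLM.exists_eval_eq (Φ : StrongDual 𝕜 (X →L_c[𝕜] 𝕜)) :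
    ∃ x : X, ∀ f : X →L_c[𝕜] 𝕜, Φ f = f x := by
  let _ : NormedSpace ℝ X := NormedSpace.restrictScalars ℝ 𝕜 X
  have : IsScalarTower ℝ 𝕜 X := RestrictScalars.isScalarTower ℝ 𝕜 X
  have h : {f : X →L_c[𝕜] 𝕜 | ‖Φ f‖ < 1} ∈ 𝓝 0 :=
    (isOpen_lt Φ.continuous.norm continuous_const).mem_nhds (by simp)
  obtain ⟨⟨K, r⟩, ⟨hK, hr⟩, hKr⟩ :=
    (CompactConvergenceCLM.hasBasis_nhds_zero_of_basis Metric.nhds_basis_ball).mem_iff.1 h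
  dsimp only at hK hr
  obtain ⟨M, hKM, hM, hne, hbal, hconv⟩ := hK.exists_isCompact_balanced_convex (𝕜 := 𝕜)
  let E : X →ₗ[𝕜] (X →L_c[𝕜] 𝕜) →ₗ[𝕜] 𝕜 := (ContinuousLinearMap.coeLM 𝕜).flip
  have hcont : Continuous fun (x : X) (f : X →L_c[𝕜] 𝕜) => E x f :=
    continuous_pi fun f => map_continuous f
  obtain ⟨x, -, hx⟩ := E.exists_mem_smul_of_isCompact_image_coe (hM.image hcont) hne hbal hconv
    (Φ := Φ.toLinearMap) (inv_pos.2 hr)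
    fun f t ht hf => LinearMap.norm_le_inv_mul_of_forall_lt (Φ := Φ.toLinearMap)
      (l := fun x : K => E x) hr (fun f hf => hKr fun x hx => mem_ball_zero_iff.2 (hf ⟨x, hx⟩)) ht
      fun x => hf x (hKM x.2)
  exact ⟨x, fun f => (LinearMap.congr_fun hx f).symm⟩

/-- A Banach space is the strong dual of its dual with the topology of compact convergence. -/
noncomputable def CompactConvergenceCLM.evalEquiv (𝕜 X : Type*) [RCLike 𝕜]
    [NormedAddCommGroup X] [NormedSpace 𝕜 X] [CompleteSpace X] :
    X ≃L[𝕜] StrongDual 𝕜 (X →L_c[𝕜] 𝕜) :=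
  let I : X →ₗ[𝕜] StrongDual 𝕜 (X →L_c[𝕜] 𝕜) :=
    { toFun := fun x =>
        { toFun := fun f => f x
          map_add' := fun _ _ => rfl
          map_smul' := fun _ _ => rfl
          cont := continuous_eval_const x }
      map_add' := fun x y => ContinuousLinearMap.ext fun f => map_add f x y
      map_smul' := fun c x => ContinuousLinearMap.ext fun f => map_smul f c x }
  have hI : Function.Bijective I := by
    refine ⟨fun x y hxy => ?_, fun Φ => ?_⟩
    · exact (SeparatingDual.eq_iff_forall_dual_eq (R := 𝕜)).2 fun f =>
        DFunLike.congr_fun hxy f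
    · obtain ⟨x, hx⟩ := exists_eval_eq Φ
      exact ⟨x, ContinuousLinearMap.ext fun f => (hx f).symm⟩
  { LinearEquiv.ofBijective I hI with
    continuous_toFun := by
      refine continuous_of_continuousAt_zero I ?_
      rw [ContinuousAt, map_zero, (ContinuousLinearMap.hasBasis_nhds_zero_of_basis
        Metric.nhds_basis_ball).tendsto_right_iff]
      rintro ⟨s, ε⟩ ⟨hs, hε⟩
      obtain ⟨c, hc⟩ := exists_subset_smul_dualUnitBall hs
      have hlt : ∀ᶠ x : X in 𝓝 0, ‖c‖ * ‖x‖ < ε :=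
        (continuous_const.mul continuous_norm).continuousAt.eventually_lt_const (by simpa using hε)
      filter_upwards [hlt] with x hx f hf
      obtain ⟨g, hg, rfl⟩ := hc hf
      rw [mem_ball_zero_iff]
      change ‖c • g x‖ < ε
      rw [norm_smul]
      exact (mul_le_mul_of_nonneg_left (hg x) (norm_nonneg c)).trans_lt hx
    continuous_invFun := by
      refine continuous_of_continuousAt_zero (LinearEquiv.ofBijective I hI).symm ?_
      rw [ContinuousAt, map_zero, Metric.nhds_basis_closedBall.tendsto_right_iff]
      intro ε hε
      filter_upwards [(ContinuousLinearMap.hasBasis_nhds_zero_of_basis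
        Metric.nhds_basis_closedBall).mem_of_mem (i := (dualUnitBall 𝕜 X, ε))
        ⟨isCompact_dualUnitBall.isVonNBounded 𝕜, hε⟩] with Φ hΦ
      obtain ⟨x, rfl⟩ := hI.2 Φ
      rw [mem_closedBall_zero_iff]
      have : (LinearEquiv.ofBijective I hI).symm (I x) = x :=
        (LinearEquiv.ofBijective I hI).symm_apply_apply x
      rw [this]
      obtain ⟨g, hg, hgx⟩ := exists_dual_vector'' 𝕜 x
      have hgB : (g : X →L_c[𝕜] 𝕜) ∈ dualUnitBall 𝕜 X := fun y =>
        (g.le_of_opNorm_le hg y).trans_eq (one_mul _)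
      have := mem_closedBall_zero_iff.1 (hΦ g hgB)
      change ‖g x‖ ≤ ε at this
      rwa [hgx, RCLike.norm_ofReal, abs_norm] at this }

/-- The dual of a Banach space, with the topology of compact convergence, is a prebidual of every
space isometric to that dual. -/
noncomputable def CompactConvergenceCLM.isometricPrebidual {F : Type*} [NormedAddCommGroup F]
    [NormedSpace 𝕜 F] (T : F ≃ₗᵢ[𝕜] StrongDual 𝕜 X) :
    IsometricPrebidual 𝕜 F (X →L_c[𝕜] 𝕜) where
  dualNorm := (normSeminorm 𝕜 X).comp (evalEquiv 𝕜 X).symm.toLinearMap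
  eq_zero_of_dualNorm y' h := by simpa using h
  withSeminorms := (evalEquiv 𝕜 X).symm.toHomeomorph.isInducing.withSeminorms
    (f := (evalEquiv 𝕜 X).symm.toLinearMap) (norm_withSeminorms 𝕜 X)
  complete := (completeSpace_congr (e := (evalEquiv 𝕜 X).toEquiv)
    (evalEquiv 𝕜 X).isUniformEmbedding).1 inferInstance
  φ := T.toLinearEquiv.trans ((evalEquiv 𝕜 X).arrowCongr (.refl 𝕜 𝕜)).toLinearEquiv
  isometry f := by
    constructor
    · rintro _ ⟨y', hy', rfl⟩
      change ‖T f ((evalEquiv 𝕜 X).symm y')‖ ≤ _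
      refine ((T f).le_opNorm_of_le hy').trans_eq ?_
      rw [mul_one, T.norm_map]
    · intro b hb
      have hb' : ∀ x : X, ‖x‖ ≤ 1 → ‖T f x‖ ≤ b := fun x hx =>
        hb ⟨evalEquiv 𝕜 X x, by simpa using hx, by simp⟩
      rw [← T.norm_map]
      have h0 : 0 ≤ b := by simpa using hb' 0 (by simp)
      exact ContinuousLinearMap.opNorm_le_of_unit_norm h0 fun x hx => hb' x hx.le

theorem CompactConvergenceCLM.isometricPrebidual_apply {F : Type*} [NormedAddCommGroup F]
    [NormedSpace 𝕜 F] (T : F ≃ₗᵢ[𝕜] StrongDual 𝕜 X) (f : F) (x : X) :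
    (isometricPrebidual T).φ f (evalEquiv 𝕜 X x) = T f x := by
  change T f ((evalEquiv 𝕜 X).symm (evalEquiv 𝕜 X x)) = _
  rw [ContinuousLinearEquiv.symm_apply_apply]

end CompactConvergence

/-- A strong isometric Banach linearisation on `X` turns the dual of `X` with the topology of
compact convergence into a prebidual that represents the point evaluations. -/
theorem StrongIsometricBanachLinearisation.existsUnique_isometricPrebidual
    {𝕜 F Ω X : Type*} [RCLike 𝕜] [NormedAddCommGroup F] [NormedSpace 𝕜 F] [FunLike F Ω 𝕜]
    [NormedAddCommGroup X] [NormedSpace 𝕜 X] [CompleteSpace X]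
    (L : StrongIsometricBanachLinearisation 𝕜 F Ω X) (x : Ω) :
    ∃! y' : StrongDual 𝕜 (CompactConvergenceCLM (RingHom.id 𝕜) X 𝕜),
      ∀ f : F, f x = (CompactConvergenceCLM.isometricPrebidual L.T).φ f y' := by
  have hx : ∀ f, f x = L.T f (L.δ x) := fun f => (congrFun (L.apply_comp f) x).symm
  refine ⟨CompactConvergenceCLM.evalEquiv 𝕜 X (L.δ x), fun f => ?_, fun z' hz' => ?_⟩
  · rw [CompactConvergenceCLM.isometricPrebidual_apply, hx]
  · obtain ⟨z, rfl⟩ := (CompactConvergenceCLM.evalEquiv 𝕜 X).surjective z'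
    congr 1
    refine (SeparatingDual.eq_iff_forall_dual_eq (R := 𝕜)).2 fun g => ?_
    have := hz' (L.T.symm g)
    rw [CompactConvergenceCLM.isometricPrebidual_apply, hx] at this
    simpa using this.symm

section MixedTopology

open Filter Topology Pointwise

variable {𝕜 F : Type*} [RCLike 𝕜] [NormedAddCommGroup F] [NormedSpace 𝕜 F]

theorem Bornology.IsVonNBounded.exists_forall_norm_le {G : Type*} [AddCommGroup G] [Module 𝕜 G]
    [TopologicalSpace G] {s : Set G} (hs : Bornology.IsVonNBounded 𝕜 s) {u : G →ₗ[𝕜] 𝕜}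
    (hu : Continuous u) : ∃ r, ∀ x ∈ s, ‖u x‖ ≤ r := by
  obtain ⟨r, hr⟩ := (NormedSpace.isVonNBounded_iff' 𝕜).1 (hs.image (⟨u, hu⟩ : StrongDual 𝕜 G))
  exact ⟨r, fun x hx => hr _ ⟨x, hx, rfl⟩⟩

theorem LinearMap.continuous_of_isVonNBounded_image_closedBall {G : Type*} [AddCommGroup G]
    [Module 𝕜 G] [TopologicalSpace G] [IsTopologicalAddGroup G] [ContinuousSMul 𝕜 G]
    {L : F →ₗ[𝕜] G} (h : Bornology.IsVonNBounded 𝕜 (L '' closedBall 0 1)) : Continuous L :=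
  (L.clmOfExistsBoundedImage ⟨_, closedBall_mem_nhds 0 one_pos, h⟩).continuous

/-- A linear topology for which the unit ball is bounded is coarser than the norm topology. -/
theorem normTopology_le_of_isVonNBounded {τ : TopologicalSpace F}
    (h₁ : @IsTopologicalAddGroup F τ _) (h₂ : @ContinuousSMul 𝕜 F _ _ τ)
    (hB : @Bornology.IsVonNBounded 𝕜 F _ _ _ τ (closedBall 0 1)) : normTopology F ≤ τ :=
  continuous_id_iff_le.1 <| @LinearMap.continuous_of_isVonNBounded_image_closedBall
    𝕜 F _ _ _ F _ _ τ h₁ h₂ LinearMap.id (by rwa [LinearMap.id_coe, Set.image_id])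

/-- The Dixmier–Ng theorem: `F` is the dual of a separating space `V` of functionals if its unit
ball is compact for the weak topology of `V`. -/
theorem exists_linearIsometryEquiv_strongDual {V : Type*} [NormedAddCommGroup V] [NormedSpace 𝕜 V]
    (ι : V →ₗᵢ[𝕜] StrongDual 𝕜 F)
    (hV : IsCompact ((fun (f : F) (v : V) => ι v f) '' closedBall 0 1 : Set (V → 𝕜)))
    (hsep : ∀ f : F, (∀ v, ι v f = 0) → f = 0) :
    ∃ T : F ≃ₗᵢ[𝕜] StrongDual 𝕜 V, ∀ f v, T f v = ι v f := by
  let _ : NormedSpace ℝ F := NormedSpace.restrictScalars ℝ 𝕜 F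
  have : IsScalarTower ℝ 𝕜 F := RestrictScalars.isScalarTower ℝ 𝕜 F
  let S : F →L[𝕜] StrongDual 𝕜 V := ι.toContinuousLinearMap.flip
  have hS : ∀ f v, S f v = ι v f := fun _ _ => rfl
  have hinj : ∀ f, S f = 0 → f = 0 := fun f hf => hsep f fun v => by
    rw [← hS f v, hf]; rfl
  have hle : ∀ f, ‖S f‖ ≤ ‖f‖ := fun f =>
    ContinuousLinearMap.opNorm_le_bound _ (norm_nonneg f) fun v => by
      rw [hS, mul_comm, ← ι.norm_map v]
      exact (ι v).le_opNorm f
  have hsurj : ∀ (Φ : StrongDual 𝕜 V) (C : ℝ), 0 < C → ‖Φ‖ ≤ C → ∃ f, ‖f‖ ≤ C ∧ S f = Φ := by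
    intro Φ C hC hΦ
    obtain ⟨_, ⟨g, hg, rfl⟩, hf⟩ := LinearMap.exists_mem_smul_of_isCompact_image_coe
      (ContinuousLinearMap.coeLM 𝕜 ∘ₗ S.toLinearMap) (s := closedBall (0 : F) 1) hV ⟨0, by simp⟩
      balanced_closedBall_zero (convex_closedBall 0 1) (Φ := Φ.toLinearMap) hC
      fun v r hr hv => (Φ.le_of_opNorm_le hΦ v).trans <| by
        rw [← ι.norm_map v]
        gcongr
        exact (ι v).opNorm_le_of_unit_norm hr fun x hx => hv x (mem_closedBall_zero_iff.2 hx.le)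
    refine ⟨(C : 𝕜) • g, ?_, ContinuousLinearMap.ext fun u => LinearMap.congr_fun hf u⟩
    rw [norm_smul, RCLike.norm_ofReal, abs_of_pos hC]
    exact mul_le_of_le_one_right hC.le (mem_closedBall_zero_iff.1 hg)
  have hinj' : Function.Injective S := (injective_iff_map_eq_zero S).2 hinj
  refine ⟨⟨LinearEquiv.ofBijective S.toLinearMap ⟨hinj', fun Φ => ?_⟩, fun f => ?_⟩, hS⟩
  · obtain ⟨f, -, hf⟩ := hsurj Φ (‖Φ‖ + 1) (by positivity) (by simp)
    exact ⟨f, hf⟩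
  · refine le_antisymm (hle f) (le_of_forall_pos_le_add fun ε hε => ?_)
    obtain ⟨g, hg, hgf⟩ := hsurj (S f) (‖S f‖ + ε) (by positivity) (by simp [hε.le])
    rwa [hinj' hgf] at hg

theorem Submodule.exists_linearIsometry_range_eq {E : Type u} [NormedAddCommGroup E]
    [NormedSpace 𝕜 E] [CompleteSpace E] {X : Submodule 𝕜 E} (hX : IsClosed (X : Set E)) :
    ∃ (V : Type u) (_ : NormedAddCommGroup V) (_ : NormedSpace 𝕜 V) (_ : CompleteSpace V)
      (ι : V →ₗᵢ[𝕜] E), Set.range ι = X :=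
  ⟨X, inferInstance, inferInstance, hX.completeSpace_coe, X.subtypeₗᵢ, Subtype.range_coe⟩

/-- The predual of `F` given by a closed separating space of functionals for whose weak topology
the unit ball is compact. -/
theorem exists_predual {𝕜 : Type} {F : Type u} [RCLike 𝕜] [NormedAddCommGroup F]
    [NormedSpace 𝕜 F] {X : Submodule 𝕜 (StrongDual 𝕜 F)}
    (hcl : IsClosed (X : Set (StrongDual 𝕜 F)))
    (hX : IsCompact ((fun (f : F) (u : X) => u.1 f) '' closedBall 0 1 : Set (X → 𝕜)))
    (hsep : ∀ f : F, (∀ u ∈ X, u f = 0) → f = 0) :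
    ∃ (V : Type u) (_ : NormedAddCommGroup V) (_ : NormedSpace 𝕜 V) (_ : CompleteSpace V)
      (ι : V →ₗᵢ[𝕜] StrongDual 𝕜 F) (T : F ≃ₗᵢ[𝕜] StrongDual 𝕜 V),
      (∀ f v, T f v = ι v f) ∧ Set.range ι = X := by
  obtain ⟨V, _, _, _, ι, hι⟩ := Submodule.exists_linearIsometry_range_eq hcl
  have hιX : ∀ v, ι v ∈ X := fun v => hι.subset ⟨v, rfl⟩
  have hV : IsCompact ((fun (f : F) (v : V) => ι v f) '' closedBall 0 1 : Set (V → 𝕜)) := by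
    have := hX.image (f := fun (g : X → 𝕜) (v : V) => g ⟨ι v, hιX v⟩)
      (continuous_pi fun v => continuous_apply _)
    rwa [Set.image_image] at this
  obtain ⟨T, hT⟩ := exists_linearIsometryEquiv_strongDual ι hV fun f hf => hsep f fun u hu => by
    obtain ⟨v, rfl⟩ := hι.superset hu
    exact hf v
  exact ⟨V, _, _, inferInstance, ι, T, hT, hι⟩

theorem exists_subset_smul_closedBall {𝕜 : Type} {F : Type u} [RCLike 𝕜] [NormedAddCommGroup F]
    [NormedSpace 𝕜 F] {X : Submodule 𝕜 (StrongDual 𝕜 F)}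
    (hcl : IsClosed (X : Set (StrongDual 𝕜 F)))
    (hX : IsCompact ((fun (f : F) (u : X) => u.1 f) '' closedBall 0 1 : Set (X → 𝕜)))
    (hsep : ∀ f : F, (∀ u ∈ X, u f = 0) → f = 0) {s : Set F}
    (hs : ∀ u ∈ X, ∃ r, ∀ f ∈ s, ‖u f‖ ≤ r) : ∃ c : 𝕜, s ⊆ c • closedBall (0 : F) 1 := by
  obtain ⟨V, _, _, _, ι, T, hT, hι⟩ := exists_predual hcl hX hsep
  obtain ⟨C, hC⟩ := banach_steinhaus (g := fun f : s => T f) fun v => by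
    obtain ⟨r, hr⟩ := hs (ι v) (hι.subset ⟨v, rfl⟩)
    exact ⟨r, fun f => (congrArg norm (hT f v)).trans_le (hr f f.2)⟩
  have hpos : 0 < |C| + 1 := by positivity
  have hne : ((|C| + 1 : ℝ) : 𝕜) ≠ 0 := RCLike.ofReal_ne_zero.2 hpos.ne'
  refine ⟨((|C| + 1 : ℝ) : 𝕜), fun f hf => ?_⟩
  have := hC ⟨f, hf⟩
  rw [T.norm_map] at this
  rw [Set.mem_smul_set_iff_inv_smul_mem₀ hne, mem_closedBall_zero_iff, norm_smul, norm_inv,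
    RCLike.norm_ofReal, abs_of_pos hpos, inv_mul_le_iff₀ hpos, mul_one]
  linarith [le_abs_self C]

/-- The norm-continuous functionals on `F` that are `τ`-continuous on the unit ball. -/
def ballContinuousDual (𝕜 : Type*) {F : Type*} [RCLike 𝕜] [N : NormedAddCommGroup F]
    [NormedSpace 𝕜 F] (τ : TopologicalSpace F) :
    Submodule 𝕜 (@StrongDual 𝕜 _ _ F (normTopology F) _ _) where
  carrier := {u | @ContinuousOn F 𝕜 τ _ (fun f => u f) (closedBall 0 1)}
  zero_mem' := continuousOn_const (c := (0 : 𝕜))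
  add_mem' hu hv := ContinuousOn.add hu hv
  smul_mem' c _ hu := ContinuousOn.const_smul hu c

theorem mem_ballContinuousDual {u : StrongDual 𝕜 F} (τ : TopologicalSpace F) :
    u ∈ ballContinuousDual 𝕜 τ ↔ @ContinuousOn F 𝕜 τ _ (fun f => u f) (closedBall 0 1) := Iff.rfl

theorem ContinuousLinearMap.exists_tendstoUniformlyOn_closedBall {s : Set (StrongDual 𝕜 F)}
    {u : StrongDual 𝕜 F} (hu : u ∈ closure s) {V : Set (𝕜 × 𝕜)} (hV : V ∈ uniformity 𝕜) :
    ∃ v ∈ s, ∀ x ∈ closedBall (0 : F) 1, (u x, v x) ∈ V := by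
  obtain ⟨ε, hε, hεV⟩ := Metric.mem_uniformity_dist.1 hV
  obtain ⟨v, hv, huv⟩ := SeminormedAddCommGroup.mem_closure_iff.1 hu ε hε
  refine ⟨v, hv, fun x hx => hεV ?_⟩
  rw [dist_eq_norm, ← sub_apply]
  exact (((u - v).le_opNorm_of_le (mem_closedBall_zero_iff.1 hx)).trans_eq (mul_one _)).trans_lt huv

theorem isClosed_of_forall_approx {X : Submodule 𝕜 (StrongDual 𝕜 F)}
    (h : ∀ u, (∀ V ∈ uniformity 𝕜, ∃ v ∈ X, ∀ x ∈ closedBall (0 : F) 1, (u x, v x) ∈ V) → u ∈ X) :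
    IsClosed (X : Set (StrongDual 𝕜 F)) :=
  isClosed_of_closure_subset fun u hu => h u fun _ hV =>
    ContinuousLinearMap.exists_tendstoUniformlyOn_closedBall hu hV

theorem isClosed_ballContinuousDual (τ : TopologicalSpace F) :
    IsClosed (ballContinuousDual 𝕜 τ : Set (@StrongDual 𝕜 _ _ F (normTopology F) _ _)) :=
  isClosed_of_forall_approx fun u h => (mem_ballContinuousDual τ).2 <|
    @continuousOn_of_uniform_approx_of_continuousOn F 𝕜 τ _ _ _ fun V hV => by
      obtain ⟨v, hv, h⟩ := h V hV
      exact ⟨fun f => v f, hv, h⟩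

theorem isCompact_image_ballContinuousDual (τ : TopologicalSpace F)
    (hB : @IsCompact F τ (closedBall 0 1)) :
    IsCompact ((fun (f : F) (u : ballContinuousDual 𝕜 τ) => u.1 f) '' closedBall 0 1 :
      Set (ballContinuousDual 𝕜 τ → 𝕜)) :=
  hB.image_of_continuousOn <| continuousOn_pi.2 fun u => u.2

theorem LinearMap.continuousOn_of_continuousOn_closedBall {τ : TopologicalSpace F}
    (h₂ : @ContinuousSMul 𝕜 F _ _ τ) {u : F →ₗ[𝕜] 𝕜} (hu : ContinuousOn u (closedBall 0 1))
    {s : Set F} (hs : Bornology.IsBounded s) : ContinuousOn u s := by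
  obtain ⟨r, hr, hsr⟩ := hs.exists_pos_norm_le
  have hr' : (r : 𝕜) ≠ 0 := RCLike.ofReal_ne_zero.2 hr.ne'
  have hmaps : Set.MapsTo (fun x : F => (r : 𝕜)⁻¹ • x) s (closedBall (0 : F) 1) := fun x hx => by
    rw [mem_closedBall_zero_iff, norm_smul, norm_inv, RCLike.norm_ofReal, abs_of_pos hr,
      inv_mul_le_iff₀ hr, mul_one]
    exact hsr x hx
  refine ((hu.comp (continuous_const_smul (r : 𝕜)⁻¹).continuousOn hmaps).const_smul
    (r : 𝕜)).congr fun x _ => ?_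
  change u x = (r : 𝕜) • u ((r : 𝕜)⁻¹ • x)
  rw [map_smul, smul_inv_smul₀ hr']

theorem continuous_mixedTopology {τ : TopologicalSpace F}
    (h₁ : @IsTopologicalAddGroup F τ _)
    (h₂ : @ContinuousSMul 𝕜 F _ _ τ) (hτ : normTopology F ≤ τ) {u : F →ₗ[𝕜] 𝕜}
    (hu : @Continuous _ _ (normTopology F) _ u) (huB : ContinuousOn u (closedBall 0 1)) :
    @Continuous F 𝕜 (mixedTopology 𝕜 τ) _ u := by
  have hcont : ∀ s : Set F, Bornology.IsBounded s →
      @Continuous s 𝕜 (τ.induced (↑)) _ (u ∘ (↑)) := fun s hs =>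
    (LinearMap.continuousOn_of_continuousOn_closedBall h₂ huB hs).domRestrict
  let σ : TopologicalSpace F := .induced u inferInstance
  have hσ₁ : @IsTopologicalAddGroup F σ _ := topologicalAddGroup_induced u
  have hσ₂ : @ContinuousSMul 𝕜 F _ _ σ := continuousSMul_induced u
  have hmem : τ ⊓ σ ∈ mixedTopologies 𝕜 τ := by
    refine ⟨topologicalAddGroup_inf h₁ hσ₁, @continuousSMul_inf 𝕜 F _ _ τ σ h₂ hσ₂,
      le_inf hτ hu.le_induced, inf_le_left, fun s hs => ?_⟩
    rw [induced_inf, inf_eq_left, induced_compose, ← continuous_iff_le_induced]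
    exact hcont s hs
  exact continuous_iff_le_induced.2 ((sInf_le hmem).trans inf_le_right)

theorem isCompact_mixedTopology {τ : TopologicalSpace F} (h₁ : @IsTopologicalAddGroup F τ _)
    (h₂ : @ContinuousSMul 𝕜 F _ _ τ) (hτ : normTopology F ≤ τ) {s : Set F}
    (hs : Bornology.IsBounded s) (hc : @IsCompact F τ s) :
    @IsCompact F (mixedTopology 𝕜 τ) s := by
  have h := (isLeast_mixedTopology 𝕜 τ h₁ h₂ hτ).1.2.2.2.2 s hs
  have hc' : @IsCompact s (τ.induced (↑)) Set.univ := isCompact_iff_isCompact_univ.1 hc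
  rw [← h] at hc'
  exact (@isCompact_iff_isCompact_univ F (mixedTopology 𝕜 τ) s).2 hc'

theorem StrongDual.exists_linearMap_eq (u : StrongDual 𝕜 F) :
    ∃ l : F →ₗ[𝕜] 𝕜, Continuous l ∧ ∀ f, u f = l f :=
  ⟨u.toLinearMap, u.continuous, fun _ => rfl⟩

theorem exists_forall_norm_le_of_isVonNBounded_mixedTopology {τ : TopologicalSpace F}
    (h₁ : @IsTopologicalAddGroup F τ _) (h₂ : @ContinuousSMul 𝕜 F _ _ τ)
    (hτ : normTopology F ≤ τ) {s : Set F}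
    (hs : @Bornology.IsVonNBounded 𝕜 F _ _ _ (mixedTopology 𝕜 τ) s) :
    ∀ u ∈ ballContinuousDual 𝕜 τ, ∃ r, ∀ f ∈ s, ‖u f‖ ≤ r := by
  intro u hu
  obtain ⟨l, hl, hul⟩ := StrongDual.exists_linearMap_eq u
  replace hu := (mem_ballContinuousDual τ).1 hu
  simp only [hul] at hu ⊢
  exact @Bornology.IsVonNBounded.exists_forall_norm_le 𝕜 _ F _ _ (mixedTopology 𝕜 τ) s hs l
    (continuous_mixedTopology h₁ h₂ hτ hl hu)

/-- If the unit ball is compact for `τ`, then every set bounded for the mixed topology is norm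
bounded. -/
theorem exists_subset_smul_closedBall_of_isVonNBounded_mixedTopology
    {𝕜 : Type} {F : Type u} [RCLike 𝕜] [NormedAddCommGroup F] [NormedSpace 𝕜 F]
    {τ : TopologicalSpace F} (h₁ : @IsTopologicalAddGroup F τ _)
    (h₂ : @ContinuousSMul 𝕜 F _ _ τ) (hτ : normTopology F ≤ τ)
    (hB : @IsCompact F τ (closedBall 0 1))
    (hsep : ∀ f : F, (∀ u ∈ ballContinuousDual 𝕜 τ, u f = 0) → f = 0) {s : Set F}
    (hs : @Bornology.IsVonNBounded 𝕜 F _ _ _ (mixedTopology 𝕜 τ) s) :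
    ∃ c : 𝕜, s ⊆ c • closedBall (0 : F) 1 :=
  exists_subset_smul_closedBall (isClosed_ballContinuousDual τ)
    (isCompact_image_ballContinuousDual τ hB) hsep
    (exists_forall_norm_le_of_isVonNBounded_mixedTopology h₁ h₂ hτ hs)

end MixedTopology

section SaksSpace

open Filter Topology Pointwise

variable {𝕜 : Type*} [RCLike 𝕜]

theorem LocallyConvexHausdorff.induced {E G : Type*} [AddCommGroup E] [Module 𝕜 E]
    [AddCommGroup G] [Module 𝕜 G] [TopologicalSpace G] [LocallyConvexHausdorff 𝕜 G]
    {f : E →ₗ[𝕜] G} (hf : Function.Injective f) :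
    LocallyConvexHausdorff 𝕜 E (t := .induced f inferInstance) :=
  let _ : TopologicalSpace E := .induced f inferInstance
  { topologicalAddGroup_induced f, continuousSMul_induced f, PolynormableSpace.induced (𝕜 := 𝕜) f,
    (IsEmbedding.mk ⟨rfl⟩ hf).t2Space with }

theorem locallyConvexHausdorff_pointwiseTopology {F Ω : Type*} [NormedAddCommGroup F]
    [NormedSpace 𝕜 F] [FunLike F Ω 𝕜] [IsAddApply F Ω 𝕜] [IsSMulApply 𝕜 F Ω 𝕜] :
    LocallyConvexHausdorff 𝕜 F (t := pointwiseTopology 𝕜 F) :=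
  have : LocallyConvexHausdorff 𝕜 (Ω → 𝕜) := { }
  let ι : F →ₗ[𝕜] Ω → 𝕜 :=
    { toFun := fun f => f
      map_add' := fun f g => funext fun x => add_apply f g x
      map_smul' := fun c f => funext fun x => _root_.smul_apply f c x }
  .induced (f := ι) DFunLike.coe_injective

theorem Seminorm.norm_le_of_forall_le_one {E : Type*} [AddCommGroup E] [Module 𝕜 E]
    {N : Seminorm 𝕜 E} {f : E →ₗ[𝕜] 𝕜}
    (hf : ∀ x, N x ≤ 1 → ‖f x‖ ≤ 1) (x : E) : ‖f x‖ ≤ N x := by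
  refine le_of_forall_gt_imp_ge_of_dense fun t ht => ?_
  have ht0 : 0 < t := (apply_nonneg N x).trans_lt ht
  have hn : ‖((t : 𝕜))⁻¹‖ = t⁻¹ := by rw [norm_inv, RCLike.norm_ofReal, abs_of_pos ht0]
  have := hf ((t : 𝕜)⁻¹ • x) (by
    rw [map_smul_eq_mul, hn, inv_mul_le_iff₀ ht0, mul_one]; exact ht.le)
  rwa [map_smul, norm_smul, hn, inv_mul_le_iff₀ ht0, mul_one] at this

section Seminorm

variable {G : Type*} [AddCommGroup G] [Module 𝕜 G] [TopologicalSpace G]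

theorem withSeminorms_setOf_continuous_le [PolynormableSpace 𝕜 G] {N : Seminorm 𝕜 G}
    (hN : ∀ p : Seminorm 𝕜 G, Continuous p → ∃ C > 0, ∀ x, p x ≤ C * N x) :
    WithSeminorms fun q : {q : Seminorm 𝕜 G | Continuous q ∧ q ≤ N} => q.1 := by
  refine (PolynormableSpace.withSeminorms 𝕜 G).congr (fun q => ?_) fun p => ?_
  · exact ⟨{⟨q, q.2.1⟩}, 1, by simp [Seminorm.comp_id]⟩
  · obtain ⟨C, hC, hp⟩ := hN p p.2
    have hpos : 0 < Real.toNNReal C := Real.toNNReal_pos.2 hC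
    have hcont : Continuous ⇑((Real.toNNReal C)⁻¹ • p.1) := p.2.const_smul (Real.toNNReal C)⁻¹
    have hle : (Real.toNNReal C)⁻¹ • p.1 ≤ N := fun x => by
      change (Real.toNNReal C)⁻¹ • p.1 x ≤ N x
      rw [NNReal.smul_def, NNReal.coe_inv, Real.coe_toNNReal C hC.le, smul_eq_mul,
        inv_mul_le_iff₀ hC]
      exact hp x
    refine ⟨{⟨_, hcont, hle⟩}, Real.toNNReal C, ?_⟩
    rw [Finset.sup_singleton, smul_smul, mul_inv_cancel₀ hpos.ne', one_smul, Seminorm.comp_id]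

theorem directedOn_setOf_continuous_le (N : Seminorm 𝕜 G) :
    DirectedOn (· ≤ ·) {q : Seminorm 𝕜 G | Continuous q ∧ q ≤ N} := by
  rintro p ⟨hp, hpN⟩ q ⟨hq, hqN⟩
  exact ⟨p ⊔ q, ⟨hp.sup hq, sup_le hpN hqN⟩, le_sup_left, le_sup_right⟩

theorem isLUB_setOf_continuous_le [Module ℝ G] [IsScalarTower ℝ 𝕜 G] [IsTopologicalAddGroup G]
    [ContinuousSMul 𝕜 G] [LocallyConvexSpace ℝ G] {N : Seminorm 𝕜 G}
    (hN : IsClosed {x | N x ≤ 1}) (hconv : Convex ℝ {x | N x ≤ 1}) (x : G) :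
    IsLUB {r : ℝ | ∃ q ∈ {q : Seminorm 𝕜 G | Continuous q ∧ q ≤ N}, r = q x} (N x) := by
  refine ⟨?_, fun b hb => ?_⟩
  · rintro _ ⟨q, hq, rfl⟩
    exact hq.2 x
  have hb0 : 0 ≤ b := hb ⟨0, ⟨continuous_const, fun y => apply_nonneg N y⟩, rfl⟩
  by_contra! hlt
  obtain ⟨c, hbc, hcN⟩ := exists_between hlt
  have hc : 0 < c := hb0.trans_lt hbc
  have hn : ‖((c : 𝕜))⁻¹‖ = c⁻¹ := by rw [norm_inv, RCLike.norm_ofReal, abs_of_pos hc]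
  have hbal : Balanced 𝕜 {x | N x ≤ 1} := by
    rintro a ha _ ⟨y, hy, rfl⟩
    change N (a • y) ≤ 1
    rw [map_smul_eq_mul]
    exact mul_le_one₀ ha (apply_nonneg N y) hy
  obtain ⟨f, hf, hfx⟩ := exists_strongDual_norm_le_one_lt (𝕜 := 𝕜) ⟨0, by simp⟩ hbal hconv hN
    (x := (c : 𝕜)⁻¹ • x) (by
      rw [Set.mem_ofPred_eq, map_smul_eq_mul, hn, inv_mul_le_iff₀ hc, mul_one]
      exact hcN.not_ge)
  rw [map_smul, norm_smul, hn, lt_inv_mul_iff₀ hc, mul_one] at hfx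
  have hq : f.toLinearMap.toSeminorm x ≤ b := hb ⟨_, ⟨f.continuous.norm,
    Seminorm.norm_le_of_forall_le_one (f := f.toLinearMap) hf⟩, rfl⟩
  exact (hbc.trans hfx).not_ge hq

end Seminorm

section Ball

variable {F : Type*} [NormedAddCommGroup F] [NormedSpace 𝕜 F] {τ : TopologicalSpace F}

theorem normTopology_le_of_isCompact_closedBall (hτ : LocallyConvexHausdorff 𝕜 F (t := τ))
    (hB : @IsCompact F τ (closedBall 0 1)) : normTopology F ≤ τ :=
  normTopology_le_of_isVonNBounded (𝕜 := 𝕜) hτ.toIsTopologicalAddGroup hτ.toContinuousSMul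
    (hB.isVonNBounded 𝕜)

theorem isSaksSpace_of_isCompact_closedBall (hτ : LocallyConvexHausdorff 𝕜 F (t := τ))
    (hB : @IsCompact F τ (closedBall 0 1)) : IsSaksSpace 𝕜 τ := by
  have hn := normTopology_le_of_isCompact_closedBall hτ hB
  let _ : NormedSpace ℝ F := NormedSpace.restrictScalars ℝ 𝕜 F
  have : IsScalarTower ℝ 𝕜 F := RestrictScalars.isScalarTower ℝ 𝕜 F
  have : LocallyConvexSpace ℝ F := (PolynormableSpace.withSeminorms 𝕜 F).toLocallyConvexSpace
  have hset : {x | normSeminorm 𝕜 F x ≤ 1} = closedBall 0 1 := by ext; simp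
  refine ⟨hτ, hn, {q : Seminorm 𝕜 F | Continuous q ∧ q ≤ normSeminorm 𝕜 F},
    ⟨0, continuous_const, fun x => norm_nonneg x⟩, directedOn_setOf_continuous_le _,
    withSeminorms_setOf_continuous_le fun p hp =>
      Seminorm.bound_of_continuous_normedSpace p (continuous_le_dom hn hp),
    isLUB_setOf_continuous_le ?_ ?_⟩
  · rw [hset]
    exact hB.isClosed
  · rw [hset]
    exact convex_closedBall 0 1

theorem IsSaksSpace.isClosed_closedBall (h : IsSaksSpace 𝕜 τ) :
    @IsClosed F τ (closedBall 0 1) := by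
  obtain ⟨Γ, -, -, hΓ, hlub⟩ := h.exists_seminorms
  have : closedBall (0 : F) 1 = ⋂ q : Γ, {x | q.1 x ≤ 1} := by
    ext x
    rw [mem_closedBall_zero_iff, isLUB_le_iff (hlub x), Set.mem_iInter]
    exact ⟨fun hx q => hx ⟨q, q.2, rfl⟩, by rintro hx _ ⟨q, hq, rfl⟩; exact hx ⟨q, hq⟩⟩
  rw [this]
  exact isClosed_iInter fun q => isClosed_le (hΓ.continuous_seminorm q) continuous_const

theorem exists_continuous_linearMap_norm_le_one_lt [Module ℝ F] [IsScalarTower ℝ 𝕜 F]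
    (hτ : LocallyConvexHausdorff 𝕜 F (t := τ)) {s : Set F} (hcl : IsClosed s)
    (hne : s.Nonempty) (hbal : Balanced 𝕜 s) (hconv : Convex ℝ s) {x : F} (hx : x ∉ s) :
    ∃ u : F →ₗ[𝕜] 𝕜, Continuous u ∧ (∀ f ∈ s, ‖u f‖ ≤ 1) ∧ 1 < ‖u x‖ := by
  have : LocallyConvexSpace ℝ F := (PolynormableSpace.withSeminorms 𝕜 F).toLocallyConvexSpace
  obtain ⟨u, hu⟩ := exists_strongDual_norm_le_one_lt (𝕜 := 𝕜) hne hbal hconv hcl hx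
  exact ⟨u.toLinearMap, u.continuous, hu⟩

theorem LinearMap.exists_mem_ballContinuousDual (hn : normTopology F ≤ τ) {u : F →ₗ[𝕜] 𝕜}
    (hu : Continuous u) : ∃ v ∈ ballContinuousDual 𝕜 τ, ∀ f, v f = u f :=
  ⟨@ContinuousLinearMap.mk 𝕜 𝕜 _ _ _ F (normTopology F) _ 𝕜 _ _ _ _ u (continuous_le_dom hn hu),
    hu.continuousOn, fun _ => rfl⟩

theorem eq_zero_of_forall_ballContinuousDual (hτ : LocallyConvexHausdorff 𝕜 F (t := τ))
    (hn : normTopology F ≤ τ) {f : F} (hf : ∀ u ∈ ballContinuousDual 𝕜 τ, u f = 0) : f = 0 := by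
  by_contra hne
  let _ : NormedSpace ℝ F := NormedSpace.restrictScalars ℝ 𝕜 F
  have : IsScalarTower ℝ 𝕜 F := RestrictScalars.isScalarTower ℝ 𝕜 F
  obtain ⟨u, hu, -, huf⟩ := exists_continuous_linearMap_norm_le_one_lt hτ (s := {0})
    isClosed_singleton ⟨0, rfl⟩ (fun c _ => by simp) (convex_singleton 0) hne
  obtain ⟨v, hv, hvu⟩ := LinearMap.exists_mem_ballContinuousDual hn hu
  rw [← hvu, hf v hv, norm_zero] at huf
  exact zero_le_one.not_gt huf

theorem continuousSMul_mixedTopology (hτ : LocallyConvexHausdorff 𝕜 F (t := τ))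
    (hn : normTopology F ≤ τ) : @ContinuousSMul 𝕜 F _ _ (mixedTopology 𝕜 τ) :=
  (isLeast_mixedTopology 𝕜 τ hτ.toIsTopologicalAddGroup hτ.toContinuousSMul hn).1.2.1

theorem normTopology_le_mixedTopology (hτ : LocallyConvexHausdorff 𝕜 F (t := τ))
    (hn : normTopology F ≤ τ) : normTopology F ≤ mixedTopology 𝕜 τ :=
  (isLeast_mixedTopology 𝕜 τ hτ.toIsTopologicalAddGroup hτ.toContinuousSMul hn).1.2.2.1

theorem mixedTopology_le (hτ : LocallyConvexHausdorff 𝕜 F (t := τ))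
    (hn : normTopology F ≤ τ) : mixedTopology 𝕜 τ ≤ τ :=
  (isLeast_mixedTopology 𝕜 τ hτ.toIsTopologicalAddGroup hτ.toContinuousSMul hn).1.2.2.2.1

theorem t2Space_mixedTopology (hτ : LocallyConvexHausdorff 𝕜 F (t := τ))
    (hn : normTopology F ≤ τ) : @T2Space F (mixedTopology 𝕜 τ) :=
  t2Space_antitone (mixedTopology_le hτ hn) hτ.toT2Space

theorem isVonNBounded_mixedTopology_closedBall (hτ : LocallyConvexHausdorff 𝕜 F (t := τ))
    (hn : normTopology F ≤ τ) :
    @Bornology.IsVonNBounded 𝕜 F _ _ _ (mixedTopology 𝕜 τ) (closedBall 0 1) :=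
  .of_topologicalSpace_le (normTopology_le_mixedTopology hτ hn)
    (NormedSpace.isVonNBounded_closedBall 𝕜 F 1)

end Ball

section SemiMontel

variable {𝕜 : Type} {F : Type u} [RCLike 𝕜] [NormedAddCommGroup F] [NormedSpace 𝕜 F]
  {τ : TopologicalSpace F}

theorem exists_subset_smul_closedBall_of_isVonNBounded (hτ : LocallyConvexHausdorff 𝕜 F (t := τ))
    (hB : @IsCompact F τ (closedBall 0 1)) {s : Set F}
    (hs : @Bornology.IsVonNBounded 𝕜 F _ _ _ (mixedTopology 𝕜 τ) s) :
    ∃ c : 𝕜, s ⊆ c • closedBall (0 : F) 1 :=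
  have hn := normTopology_le_of_isCompact_closedBall hτ hB
  exists_subset_smul_closedBall_of_isVonNBounded_mixedTopology hτ.toIsTopologicalAddGroup
    hτ.toContinuousSMul hn hB (fun _ => eq_zero_of_forall_ballContinuousDual hτ hn) hs

theorem isCompact_mixedTopology_closedBall (hτ : LocallyConvexHausdorff 𝕜 F (t := τ))
    (hB : @IsCompact F τ (closedBall 0 1)) :
    @IsCompact F (mixedTopology 𝕜 τ) (closedBall 0 1) :=
  isCompact_mixedTopology hτ.toIsTopologicalAddGroup hτ.toContinuousSMul
    (normTopology_le_of_isCompact_closedBall hτ hB) isBounded_closedBall hB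

theorem isSemiMontelSaksSpace_of_isCompact_closedBall
    (hτ : LocallyConvexHausdorff 𝕜 F (t := τ)) (hB : @IsCompact F τ (closedBall 0 1)) :
    IsSemiMontelSaksSpace 𝕜 τ :=
  have hn := normTopology_le_of_isCompact_closedBall hτ hB
  ⟨isSaksSpace_of_isCompact_closedBall hτ hB, @IsCompact.isSemiMontel 𝕜 _ F _ _
    (mixedTopology 𝕜 τ) (closedBall 0 1) (t2Space_mixedTopology hτ hn)
    (@ContinuousSMul.continuousConstSMul 𝕜 F _ (mixedTopology 𝕜 τ) _
      (continuousSMul_mixedTopology hτ hn))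
    (isCompact_mixedTopology_closedBall hτ hB)
    fun _ => exists_subset_smul_closedBall_of_isVonNBounded hτ hB⟩

theorem isSemiReflexiveSaksSpace_of_isCompact_closedBall
    (hτ : LocallyConvexHausdorff 𝕜 F (t := τ)) (hB : @IsCompact F τ (closedBall 0 1)) :
    IsSemiReflexiveSaksSpace 𝕜 τ :=
  let _ : NormedSpace ℝ F := NormedSpace.restrictScalars ℝ 𝕜 F
  ⟨isSaksSpace_of_isCompact_closedBall hτ hB, @IsCompact.isSemiReflexive 𝕜 _ F _ _
    (mixedTopology 𝕜 τ) (closedBall 0 1) _ (RestrictScalars.isScalarTower ℝ 𝕜 F)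
    (isCompact_mixedTopology_closedBall hτ hB) ⟨0, by simp⟩ balanced_closedBall_zero
    (convex_closedBall 0 1) fun _ => exists_subset_smul_closedBall_of_isVonNBounded hτ hB⟩

end SemiMontel

end SaksSpace

section Pointwise

open Filter Topology

variable {𝕜 F : Type*} [RCLike 𝕜]

theorem IsCompact.of_topologicalSpace_le {X : Type*} {t t' : TopologicalSpace X} {s : Set X}
    (hs : @IsCompact X t s) (h : t ≤ t') : @IsCompact X t' s := by
  have := @IsCompact.image X X t t' s id hs (continuous_id_iff_le.2 h)
  rwa [Set.image_id] at this

theorem isCompact_pointwiseTopology {Ω V : Type*} [FunLike F Ω 𝕜] {B : F → V → 𝕜} {s : Set F}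
    (hs : IsCompact (B '' s)) {y : Ω → V} (hy : ∀ (f : F) (x : Ω), f x = B f (y x)) :
    @IsCompact F (pointwiseTopology 𝕜 F) s := by
  let _ : TopologicalSpace F := pointwiseTopology 𝕜 F
  have hind : IsInducing fun f : F => (f : Ω → 𝕜) := ⟨rfl⟩
  rw [hind.isCompact_iff]
  have := hs.image (f := fun (g : V → 𝕜) (x : Ω) => g (y x))
    (continuous_pi fun x => continuous_apply _)
  rw [Set.image_image] at this
  convert this using 4 with f
  exact hy _ _

theorem continuous_apply_pointwiseTopology {Ω : Type*} [FunLike F Ω 𝕜] (x : Ω) :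
    @Continuous F 𝕜 (pointwiseTopology 𝕜 F) _ (fun f => f x) :=
  @Continuous.comp F (Ω → 𝕜) 𝕜 (pointwiseTopology 𝕜 F) _ _ _ _ (continuous_apply x)
    continuous_induced_dom

theorem isCompact_pointwiseTopology_of_continuous {Ω : Type*} [FunLike F Ω 𝕜]
    {t : TopologicalSpace F} {s : Set F} (hs : IsCompact s)
    (h : ∀ x : Ω, Continuous fun f : F => f x) : @IsCompact F (pointwiseTopology 𝕜 F) s :=
  hs.of_topologicalSpace_le (continuous_iff_le_induced.1 (continuous_pi h))

variable [NormedAddCommGroup F] [NormedSpace 𝕜 F]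

theorem IsometricPrebidual.norm_apply_le {Y : Type*} [AddCommGroup Y] [Module 𝕜 Y]
    [TopologicalSpace Y] [LocallyConvexHausdorff 𝕜 Y] (P : IsometricPrebidual 𝕜 F Y) {f : F}
    (hf : ‖f‖ ≤ 1) (y' : StrongDual 𝕜 Y) : ‖P.φ f y'‖ ≤ P.dualNorm y' :=
  Seminorm.norm_le_of_forall_le_one (f := (P.φ f).toLinearMap)
    (fun z' hz' => ((P.isometry f).1 ⟨z', hz', rfl⟩).trans hf) y'

theorem IsometricPrebidual.isCompact_image_closedBall {Y : Type*} [AddCommGroup Y] [Module 𝕜 Y]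
    [TopologicalSpace Y] [LocallyConvexHausdorff 𝕜 Y] (P : IsometricPrebidual 𝕜 F Y) :
    IsCompact ((fun f y' => P.φ f y') '' closedBall 0 1 : Set (StrongDual 𝕜 Y → 𝕜)) := by
  refine LinearMap.isCompact_image_coe (ContinuousLinearMap.coeLM 𝕜 ∘ₗ P.φ.toLinearMap)
    (fun y' => ⟨P.dualNorm y', fun f hf => P.norm_apply_le (mem_closedBall_zero_iff.1 hf) y'⟩)
    fun Φ hΦ => ?_
  have hle : ∀ y', ‖Φ y'‖ ≤ P.dualNorm y' := fun y' =>
    hΦ y' _ fun f hf => P.norm_apply_le (mem_closedBall_zero_iff.1 hf) y'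
  have hcont : Continuous Φ := by
    refine continuous_of_continuousAt_zero Φ ?_
    rw [ContinuousAt, map_zero]
    refine squeeze_zero_norm hle ?_
    have : Continuous P.dualNorm := P.withSeminorms.continuous_seminorm 0
    simpa using this.tendsto 0
  refine ⟨P.φ.symm ⟨Φ, hcont⟩, mem_closedBall_zero_iff.2 <| (P.isometry _).2 ?_, ?_⟩
  · rintro _ ⟨y', hy', rfl⟩
    rw [LinearEquiv.apply_symm_apply]
    exact (hle y').trans hy'
  · rw [LinearMap.comp_apply, LinearEquiv.coe_coe, LinearEquiv.apply_symm_apply]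
    rfl

theorem IsSemiMontelSaksSpace.isCompact_closedBall {τ : TopologicalSpace F}
    (h : IsSemiMontelSaksSpace 𝕜 τ) : @IsCompact F τ (closedBall 0 1) := by
  have hτ := h.1.locallyConvexHausdorff
  have hle := mixedTopology_le hτ h.1.norm_le
  have hc := h.2 _ (isVonNBounded_mixedTopology_closedBall hτ h.1.norm_le)
  rw [@IsClosed.closure_eq F (mixedTopology 𝕜 τ) _ (h.1.isClosed_closedBall.mono hle)] at hc
  exact hc.of_topologicalSpace_le hle

theorem IsSemiReflexiveSaksSpace.isCompact_pointwiseTopology {Ω : Type*} [FunLike F Ω 𝕜]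
    [IsAddApply F Ω 𝕜] [IsSMulApply 𝕜 F Ω 𝕜] {τ : TopologicalSpace F}
    (h : IsSemiReflexiveSaksSpace 𝕜 τ) (hp : τ ≤ pointwiseTopology 𝕜 F) :
    @IsCompact F (pointwiseTopology 𝕜 F) (closedBall 0 1) := by
  have hτ := h.1.locallyConvexHausdorff
  have hle := mixedTopology_le hτ h.1.norm_le
  let _ : NormedSpace ℝ F := NormedSpace.restrictScalars ℝ 𝕜 F
  have : IsScalarTower ℝ 𝕜 F := RestrictScalars.isScalarTower ℝ 𝕜 F
  have hc := @IsSemiReflexive.isCompact_image_coe 𝕜 _ F _ _ (mixedTopology 𝕜 τ) (closedBall 0 1)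
    h.2 (isVonNBounded_mixedTopology_closedBall hτ h.1.norm_le) fun f hf => by
      obtain ⟨u, hu, huB⟩ := exists_continuous_linearMap_norm_le_one_lt hτ
        h.1.isClosed_closedBall ⟨0, by simp⟩ balanced_closedBall_zero (convex_closedBall 0 1) hf
      exact ⟨@ContinuousLinearMap.mk 𝕜 𝕜 _ _ _ F (mixedTopology 𝕜 τ) _ 𝕜 _ _ _ _ u
        (continuous_le_dom hle hu), huB⟩
  let δ : Ω → F →ₗ[𝕜] 𝕜 := fun x =>
    { toFun := fun f => f x
      map_add' := fun f g => add_apply f g x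
      map_smul' := fun c f => _root_.smul_apply f c x }
  exact _root_.isCompact_pointwiseTopology hc (y := fun x =>
    @ContinuousLinearMap.mk 𝕜 𝕜 _ _ _ F (mixedTopology 𝕜 τ) _ 𝕜 _ _ _ _ (δ x)
      (continuous_le_dom (hle.trans hp) (continuous_apply_pointwiseTopology x))) fun _ _ => rfl

theorem exists_strongIsometricBanachLinearisation {𝕜 : Type} {F : Type u} [RCLike 𝕜]
    [NormedAddCommGroup F] [NormedSpace 𝕜 F] {Ω : Type*} [FunLike F Ω 𝕜] [IsAddApply F Ω 𝕜]
    [IsSMulApply 𝕜 F Ω 𝕜] (h : @IsCompact F (pointwiseTopology 𝕜 F) (closedBall 0 1)) :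
    ∃ (Y : Type u) (_ : NormedAddCommGroup Y) (_ : NormedSpace 𝕜 Y) (_ : CompleteSpace Y),
      Nonempty (StrongIsometricBanachLinearisation 𝕜 F Ω Y) := by
  have hτ : LocallyConvexHausdorff 𝕜 F (t := pointwiseTopology 𝕜 F) :=
    locallyConvexHausdorff_pointwiseTopology
  have hn := normTopology_le_of_isCompact_closedBall hτ h
  obtain ⟨V, _, _, _, ι, T, hT, hι⟩ := exists_predual
    (isClosed_ballContinuousDual (pointwiseTopology 𝕜 F))
    (isCompact_image_ballContinuousDual _ h) fun _ => eq_zero_of_forall_ballContinuousDual hτ hn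
  have hδ : ∀ x : Ω, ∃ v : V, ∀ f : F, T f v = f x := fun x => by
    let δ : F →ₗ[𝕜] 𝕜 :=
      { toFun := fun f => f x
        map_add' := fun f g => add_apply f g x
        map_smul' := fun c f => _root_.smul_apply f c x }
    obtain ⟨u, hu, huδ⟩ := LinearMap.exists_mem_ballContinuousDual hn (u := δ)
      (continuous_apply_pointwiseTopology x)
    obtain ⟨v, rfl⟩ := hι.superset hu
    exact ⟨v, fun f => (hT f v).trans (huδ f)⟩
  choose δ hδ using hδ
  exact ⟨V, _, _, inferInstance, ⟨δ, T, fun f => funext fun x => hδ x f⟩⟩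

end Pointwise

/-- `F` is a Banach space of `𝕜`-valued functions on `Ω`: its elements are (coerced injectively to)
functions on `Ω`, with pointwise addition and scalar multiplication. -/
theorem theorem4 {𝕜 : Type} [RCLike 𝕜] {Ω : Type v} [Nonempty Ω]
    {F : Type u} [NormedAddCommGroup F] [NormedSpace 𝕜 F] [CompleteSpace F]
    [FunLike F Ω 𝕜] [IsAddApply F Ω 𝕜] [IsSMulApply 𝕜 F Ω 𝕜] :
    [ -- (a)
      ∃ (Y : Type u) (_ : NormedAddCommGroup Y) (_ : NormedSpace 𝕜 Y) (_ : CompleteSpace Y),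
        Nonempty (StrongIsometricBanachLinearisation 𝕜 F Ω Y),
      -- (b)
      ∃ (Y : Type u) (_ : AddCommGroup Y) (_ : Module 𝕜 Y) (_ : UniformSpace Y)
        (_ : IsUniformAddGroup Y) (_ : LocallyConvexHausdorff 𝕜 Y)
        (P : IsometricPrebidual 𝕜 F Y),
        CompleteSpace Y ∧ IsSemiMontel 𝕜 Y ∧
          ∀ x : Ω, ∃! y' : StrongDual 𝕜 Y, ∀ f : F, f x = P.φ f y',
      -- (c)
      ∃ (Y : Type u) (_ : AddCommGroup Y) (_ : Module 𝕜 Y) (_ : TopologicalSpace Y)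
        (_ : LocallyConvexHausdorff 𝕜 Y) (P : IsometricPrebidual 𝕜 F Y),
          ∀ x : Ω, ∃! y' : StrongDual 𝕜 Y, ∀ f : F, f x = P.φ f y',
      -- (d)
      ∃ τ : TopologicalSpace F, LocallyConvexHausdorff 𝕜 F (t := τ) ∧
        normTopology F ≤ τ ∧ τ ≤ pointwiseTopology 𝕜 F ∧
        IsSemiReflexiveSaksSpace 𝕜 τ,
      -- (e)
      ∃ τ : TopologicalSpace F, LocallyConvexHausdorff 𝕜 F (t := τ) ∧
        normTopology F ≤ τ ∧ τ ≤ pointwiseTopology 𝕜 F ∧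
        IsSemiMontelSaksSpace 𝕜 τ,
      -- (f)
      ∃ τ : TopologicalSpace F, LocallyConvexHausdorff 𝕜 F (t := τ) ∧
        τ ≤ pointwiseTopology 𝕜 F ∧ @IsCompact F τ (closedBall 0 1),
      -- (g)
      ∃ τ : TopologicalSpace F, LocallyConvexHausdorff 𝕜 F (t := τ) ∧
        @IsCompact F τ (closedBall 0 1) ∧
        ∀ x : Ω, @Continuous F 𝕜 (mixedTopology 𝕜 τ) _ (fun f : F => f x),
      -- (h)
      @IsCompact F (pointwiseTopology 𝕜 F) (closedBall 0 1)].TFAE := by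
  have hp : LocallyConvexHausdorff 𝕜 F (t := pointwiseTopology 𝕜 F) :=
    locallyConvexHausdorff_pointwiseTopology
  tfae_have 1 → 2
  | ⟨X, _, _, _, ⟨L⟩⟩ =>
    ⟨CompactConvergenceCLM (RingHom.id 𝕜) X 𝕜, inferInstance, inferInstance, inferInstance,
      inferInstance, inferInstance, CompactConvergenceCLM.isometricPrebidual L.T, inferInstance,
      CompactConvergenceCLM.isSemiMontel, L.existsUnique_isometricPrebidual⟩
  tfae_have 2 → 3
  | ⟨Y, _, _, _, _, _, P, _, _, hP⟩ => ⟨Y, _, _, _, _, P, hP⟩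
  tfae_have 3 → 8
  | ⟨Y, _, _, _, _, P, hP⟩ => by
    choose y hy _ using hP
    exact isCompact_pointwiseTopology P.isCompact_image_closedBall fun f x => hy x f
  tfae_have 8 → 1 := exists_strongIsometricBanachLinearisation
  tfae_have 8 → 4
  | h => ⟨_, hp, normTopology_le_of_isCompact_closedBall hp h, le_rfl,
      isSemiReflexiveSaksSpace_of_isCompact_closedBall hp h⟩
  tfae_have 4 → 8
  | ⟨_, _, _, hle, h⟩ => h.isCompact_pointwiseTopology hle
  tfae_have 8 → 5
  | h => ⟨_, hp, normTopology_le_of_isCompact_closedBall hp h, le_rfl,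
      isSemiMontelSaksSpace_of_isCompact_closedBall hp h⟩
  tfae_have 5 → 8
  | ⟨_, _, _, hle, h⟩ => h.isCompact_closedBall.of_topologicalSpace_le hle
  tfae_have 8 → 6
  | h => ⟨_, hp, le_rfl, h⟩
  tfae_have 6 → 8
  | ⟨_, _, hle, h⟩ => h.of_topologicalSpace_le hle
  tfae_have 8 → 7
  | h => ⟨_, hp, h, fun x => continuous_le_dom
      (mixedTopology_le hp (normTopology_le_of_isCompact_closedBall hp h))
      (continuous_apply_pointwiseTopology x)⟩
  tfae_have 7 → 8
  | ⟨_, hτ, hB, h⟩ => isCompact_pointwiseTopology_of_continuous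
      (isCompact_mixedTopology_closedBall hτ hB) h
  tfae_finish
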